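/- **Lemma (Model equivalence).** Let $n,L\ge 1$, and let $\mathcal P$ be a controllable and observable discrete-time LTI system $x_{k+1}=Ax_k+Bu_k$, $y_k=Cx_k+Du_k$ with $x_k\in\mathbb R^n$, $u_k\in\mathbb R^m$, $y_k\in\mathbb R^p$. Let $\{u^d_k,y^d_k\}_{k=0}^{N+n-1}$ be a (noiseless) trajectory of $\mathcal P$ with states $x^d_0,\dots,x^d_{N+n}$, such that $u^d=\{u^d_k\}_{k=0}^{N-1}$ is persistently exciting of order $L+2n$, i.e. $\operatorname{rank}H_{L+2n}(u^d)=m(L+2n)$. Here $H_M(w)$ is the block Hankel matrix with $M$ block rows of $w_0,\dots,w_{N-1}$ (block $(i,j)$, counted from $0$, is $w_{i+j}$, and there are $N-M+1$ columns), and $w_{[a,b]}$ is the stacked vector $[w_a;\dots;w_b]$. The *trajectory model* is $$\begin{bmatrix}\bar u_{[-n,L-1]}\\ \bar y_{[-n,L-1]}\end{bmatrix}=\begin{bmatrix}H_{L+n}(u^d)\\ H_{L+n}(y^d)\end{bmatrix}\alpha,\qquad \alpha\in\mathbb R^{N-L-n+1}.\tag{T}$$ For a sequence $\xi^d_n,\dots,\xi^d_{N+n}$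 of data states, put $U_{0,1,N}=[u^d_n,\dots,u^d_{N+n-1}]$, $X_{0,N}=[\xi^d_n,\dots,\xi^d_{N+n-1}]$, $X_{1,N}=[\xi^d_{n+1},\dots,\xi^d_{N+n}]$. The *one-step predictor* is $$\bar\xi_{k+1}=X_{1,N}\begin{bmatrix}U_{0,1,N}\\ X_{0,N}\end{bmatrix}^{\dagger}\begin{bmatrix}\bar u_k\\ \bar\xi_k\end{bmatrix},\qquad k=0,\dots,L-1,\tag{E}$$ where $M^\dagger$ is any right inverse of $M$ and, if $M$ does not have full row rank, any matrix with $MM^\dagger M=M$ (e.g. the Moore–Penrose inverse). Write $H_L(\xi_d^+)$ for the block Hankel matrix with $L$ block rows and $N-L-n+1$ columns whose block $(i,j)$ is $\xi^d_{n+1+i+j}$. For every choice of $M^\dagger$ the models (T) and (E) are equivalent, in the following sense. (i) *Fully measured state* ($p=n$, $C=I$, $D=0$, so $y=x$; $\xi^d_k=x^d_k$). The matrix $[U_{0,1,N};X_{0,N}]$ has a right inverse. For all $\bar u_{[-n,L-1]}$, $\bar y_{[-n,L-1]}$: (T) holds for some $\alpha$ if and only if $\{\bar u_k,\bar y_k\}_{k=-n}^{-1}$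 is a trajectory of $\mathcal P$ with final state $\bar y_0$ and there are $\bar\xi_0,\dots,\bar\xi_L$ with $\bar\xi_k=\bar y_k$ for $0\le k\le L-1$ that satisfy (E) with the inputs $\bar u_0,\dots,\bar u_{L-1}$. Moreover, $\bar u_{[0,L-1]}$, $\bar\xi_{[0,L]}$ satisfy (E) if and only if there are $\alpha$ and $\bar u_{[-n,-1]}$, $\bar y_{[-n,L-1]}$ such that (T) holds, $\bar y_k=\bar\xi_k$ for $0\le k\le L-1$, and $\bar\xi_{[1,L]}=H_L(\xi_d^+)\alpha$. (ii) *Non-minimal state* (any $p$; $\xi^d_k=z^d_k=[u^d_{k-n};\dots;u^d_{k-1};y^d_{k-n};\dots;y^d_{k-1}]\in\mathbb R^{n(m+p)}$). If $p=1$, the matrix $[U_{0,1,N};X_{0,N}]$ has a right inverse. For all $\bar u_{[-n,L-1]}$, $\bar y_{[-n,L-1]}$: (T) holds for some $\alpha$ if and only if $\{\bar u_k,\bar y_k\}_{k=-n}^{-1}$ is a trajectory of $\mathcal P$ and $\bar\xi_k=[\bar u_{k-n};\dots;\bar u_{k-1};\bar y_{k-n};\dots;\bar y_{k-1}]$, $k=0,\dots,L$,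 satisfies (E) with the inputs $\bar u_0,\dots,\bar u_{L-1}$. Moreover, for all $\bar u_{[0,L-1]}$, $\bar\xi_{[0,L]}$: $\bar\xi_0=[u_0;\dots;u_{n-1};y_0;\dots;y_{n-1}]$ for some trajectory $\{u_k,y_k\}_{k=0}^{n-1}$ of $\mathcal P$ and (E) holds, if and only if there are $\alpha$ and $\bar u_{[-n,-1]}$, $\bar y_{[-n,L-1]}$ such that (T) holds, $\bar\xi_0=[\bar u_{[-n,-1]};\bar y_{[-n,-1]}]$ and $\bar\xi_{[1,L]}=H_L(\xi_d^+)\alpha$. -/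

import Mathlib

open Matrix

/-- A discrete-time linear time-invariant state-space system with `n` states, `m` inputs and
`p` outputs: `x⁺ = A x + B u`, `y = C x + D u`. -/
structure LTISystem (n m p : ℕ) where
  A : Matrix (Fin n) (Fin n) ℝ
  B : Matrix (Fin n) (Fin m) ℝ
  C : Matrix (Fin p) (Fin n) ℝ
  D : Matrix (Fin p) (Fin m) ℝ

namespace LTISystem

variable {n m p : ℕ}

/-- The controllability matrix `[B, AB, …, A^(n-1) B]`. -/
def ctrbMatrix (P : LTISystem n m p) : Matrix (Fin n) (Fin n × Fin m) ℝ :=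
  Matrix.of fun i j => (P.A ^ (j.1 : ℕ) * P.B) i j.2

/-- The observability matrix `[C; CA; …; C A^(n-1)]`. -/
def obsvMatrix (P : LTISystem n m p) : Matrix (Fin n × Fin p) (Fin n) ℝ :=
  Matrix.of fun i j => (P.C * P.A ^ (i.1 : ℕ)) i.2 j

/-- Controllability (Kalman rank condition). -/
def Controllable (P : LTISystem n m p) : Prop := P.ctrbMatrix.rank = n

/-- Observability (Kalman rank condition). -/
def Observable (P : LTISystem n m p) : Prop := P.obsvMatrix.rank = n

/-- `x_0, …, x_T` is a state sequence of `P` that goes with the inputs and outputs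
`u_0, …, u_{T-1}`, `y_0, …, y_{T-1}`. Only these samples are constrained. -/
def IsStateTrajectory (P : LTISystem n m p) (T : ℕ) (u : ℕ → Fin m → ℝ) (x : ℕ → Fin n → ℝ)
    (y : ℕ → Fin p → ℝ) : Prop :=
  ∀ k < T, x (k + 1) = P.A *ᵥ x k + P.B *ᵥ u k ∧ y k = P.C *ᵥ x k + P.D *ᵥ u k

/-- `(u_k, y_k)`, `k = 0, …, T-1`, is an input/output trajectory of `P`. -/
def IsTrajectory (P : LTISystem n m p) (T : ℕ) (u : ℕ → Fin m → ℝ) (y : ℕ → Fin p → ℝ) : Prop :=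
  ∃ x : ℕ → Fin n → ℝ, P.IsStateTrajectory T u x y

end LTISystem

/-- The block Hankel matrix with `L` block rows and `c` columns whose block `(i, j)` is `w_{i+j}`.
The Hankel matrix `H_L(w)` of the `N` samples `w_0, …, w_{N-1}` is the one with
`c = N - L + 1` columns. -/
def hankel {σ : Type*} (L c : ℕ) (w : ℕ → σ → ℝ) : Matrix (Fin L × σ) (Fin c) ℝ :=
  Matrix.of fun i j => w ((i.1 : ℕ) + (j : ℕ)) i.2

/-- The stacked window `[w_0; w_1; …; w_{L-1}]`. -/
def stack {σ : Type*} (L : ℕ) (w : ℕ → σ → ℝ) : Fin L × σ → ℝ :=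
  fun i => w (i.1 : ℕ) i.2

/-- The samples `w_0, …, w_{N-1}` in `ℝ^q` are persistently exciting of order `L`:
`rank H_L(w) = q L`. -/
def PersistentlyExciting {q : ℕ} (L N : ℕ) (w : ℕ → Fin q → ℝ) : Prop :=
  (hankel L (N + 1 - L) w).rank = q * L

/-- The equation `[H_{L+n}(u^d); H_{L+n}(y^d)] α = [ū_{[-n,L-1]}; ȳ_{[-n,L-1]}]`, with the Hankel
matrices built from the first `N` samples of the data. The sequences `ū`, `ȳ` are indexed from `0`,
so that index `i` stands for time `i - n`. -/
def HankelEq {m p : ℕ} (n L N : ℕ) (ud : ℕ → Fin m → ℝ) (yd : ℕ → Fin p → ℝ)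
    (α : Fin (N + 1 - (L + n)) → ℝ) (ub : ℕ → Fin m → ℝ) (yb : ℕ → Fin p → ℝ) : Prop :=
  Matrix.fromRows (hankel (L + n) (N + 1 - (L + n)) ud) (hankel (L + n) (N + 1 - (L + n)) yd) *ᵥ α
    = Sum.elim (stack (L + n) ub) (stack (L + n) yb)

/-- The trajectory-based predictive model: some `α` solves the Hankel equation. -/
def HankelModel {m p : ℕ} (n L N : ℕ) (ud : ℕ → Fin m → ℝ) (yd : ℕ → Fin p → ℝ)
    (ub : ℕ → Fin m → ℝ) (yb : ℕ → Fin p → ℝ) : Prop :=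
  ∃ α : Fin (N + 1 - (L + n)) → ℝ, HankelEq n L N ud yd α ub yb

/-- The data matrix `[w_s, w_{s+1}, …, w_{s+N-1}]`. -/
def dataMatrix {σ : Type*} (s N : ℕ) (w : ℕ → σ → ℝ) : Matrix σ (Fin N) ℝ :=
  Matrix.of fun i j => w (s + (j : ℕ)) i

/-- `[U_{0,1,N}; X_{0,N}]`, whose columns are `[u^d_k; x^d_k]`, `k = n, …, N+n-1`. -/
def regressor {m : ℕ} {σ : Type*} (n N : ℕ) (ud : ℕ → Fin m → ℝ) (xd : ℕ → σ → ℝ) :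
    Matrix (Fin m ⊕ σ) (Fin N) ℝ :=
  Matrix.fromRows (dataMatrix n N ud) (dataMatrix n N xd)

/-- `G` is an inverse of `M` in the sense `M G M = M`. If `M` has full row rank, these `G` are
exactly the right inverses of `M`; in general the Moore-Penrose inverse is one of them. -/
def IsGenInverse {ι κ : Type*} [Fintype ι] [Fintype κ] (M : Matrix ι κ ℝ) (G : Matrix κ ι ℝ) :
    Prop :=
  M * G * M = M

theorem isGenInverse_iff_of_rightInverse {ι κ : Type*} [Fintype ι] [DecidableEq ι] [Fintype κ]
    {M : Matrix ι κ ℝ} (h : ∃ R : Matrix κ ι ℝ, M * R = 1) (G : Matrix κ ι ℝ) :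
    IsGenInverse M G ↔ M * G = 1 := by
  obtain ⟨R, hR⟩ := h
  constructor
  · intro hG
    have h1 : M * G * M * R = M * R := congrArg (fun X => X * R) hG
    rwa [Matrix.mul_assoc (M * G), hR, Matrix.mul_one] at h1
  · intro hG
    unfold IsGenInverse
    rw [hG, Matrix.one_mul]

theorem exists_isGenInverse {ι κ : Type*} [Fintype ι] [DecidableEq ι] [Fintype κ] [DecidableEq κ]
    (M : Matrix ι κ ℝ) : ∃ G : Matrix κ ι ℝ, IsGenInverse M G := by
  obtain ⟨g, hg⟩ := (Matrix.toLin' M).rangeRestrict.exists_rightInverse_of_surjective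
    (LinearMap.range_rangeRestrict _)
  obtain ⟨f, hf⟩ := g.exists_extend
  refine ⟨LinearMap.toMatrix' f, ?_⟩
  unfold IsGenInverse
  apply Matrix.toLin'.injective
  ext1 i
  refine LinearMap.ext fun r => ?_
  simp only [Matrix.toLin'_mul, Matrix.toLin'_toMatrix', LinearMap.comp_apply]
  generalize LinearMap.single ℝ (fun _ : κ => ℝ) i r = x
  have h1 : f (Matrix.toLin' M x) = g ((Matrix.toLin' M).rangeRestrict x) :=
    LinearMap.congr_fun hf ((Matrix.toLin' M).rangeRestrict x)
  have h2 := LinearMap.congr_fun hg ((Matrix.toLin' M).rangeRestrict x)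
  rw [h1]
  exact congrArg Subtype.val h2

/-- The one-step data-based predictor `x̄_{k+1} = X_{1,N} [U_{0,1,N}; X_{0,N}]^† [ū_k; x̄_k]`,
`k = 0, …, L-1`, where `G` plays the role of `[U_{0,1,N}; X_{0,N}]^†` and
`X_{1,N} = [x^d_{n+1}, …, x^d_{N+n}]`. Here index `k` of `ub`, `xb` is time `k`. -/
def EDDPCModel {m : ℕ} {σ : Type*} [Fintype σ] (n L N : ℕ) (xd : ℕ → σ → ℝ)
    (G : Matrix (Fin N) (Fin m ⊕ σ) ℝ) (ub : ℕ → Fin m → ℝ) (xb : ℕ → σ → ℝ) : Prop :=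
  ∀ k < L, xb (k + 1) = (dataMatrix (n + 1) N xd * G) *ᵥ Sum.elim (ub k) (xb k)

/-- Index set of the coordinates of the non-minimal state in `ℝ^{n(m+p)}`. -/
abbrev NonMin (n m p : ℕ) : Type := (Fin n × Fin m) ⊕ (Fin n × Fin p)

/-- `[u_j; …; u_{j+n-1}; y_j; …; y_{j+n-1}]`. -/
def ioWindow {m p : ℕ} (n : ℕ) (u : ℕ → Fin m → ℝ) (y : ℕ → Fin p → ℝ) (j : ℕ) :
    NonMin n m p → ℝ :=
  Sum.elim (stack n fun i => u (j + i)) (stack n fun i => y (j + i))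

/-- The non-minimal state `z^d_k = [u_{k-n}; …; u_{k-1}; y_{k-n}; …; y_{k-1}]`, used for `k ≥ n`. -/
def nonMinData {m p : ℕ} (n : ℕ) (u : ℕ → Fin m → ℝ) (y : ℕ → Fin p → ℝ) (k : ℕ) :
    NonMin n m p → ℝ :=
  ioWindow n u y (k - n)

/-!
Both models describe the trajectories of length `L + n` of the system.

For the Hankel model this is the fundamental lemma of Willems et al.
(`LTISystem.Controllable.exists_slide_eq`). A functional `ξ · x_j + ∑_{i<K} η_i · u_{j+i}` that
vanishes along the data also vanishes when it is shifted by up to `n` steps. The combination of the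
shifts with the coefficients of the characteristic polynomial of `A` contains no state, by
Cayley–Hamilton, so persistency of excitation of order `K + n` makes all its coefficients vanish. They
are a monic linear recursion for the sequence `η_{K-1}, …, η_0, ξ B, ξ A B, …`, which is therefore zero
up to `ξ A^(n-1) B`; controllability gives `ξ = 0`. Hence the data windows combine to any initial
state and any inputs, and so to every trajectory.

For the predictor, let `W` be the regressor and `X₁` the matrix of successor states. From
`W G W = W` the vector `G W a - a` lies in the kernel of `W`. As soon as `W b = 0` implies
`X₁ b = 0`, it follows that `X₁ G W a = X₁ a`: the predictor carries a combination of the data to the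
same combination one step later (`predictor_mulVec_regressor`). For a measured state the implication
is the state equation; for the non-minimal state it is observability: zero inputs and outputs over
`n` steps force a zero state, hence a zero next output. Since all trajectories are combinations of the
data, the predictor reproduces every trajectory step by step
(`LTISystem.Controllable.predictor_state`, `LTISystem.Observable.predictor_nonMin`), and an induction
over the horizon identifies its solutions, started at a trajectory, with the trajectories. For `p ≠ 1`
the regressor of the non-minimal state may fail to have full row rank, but only values of the predictor
on the range of the regressor are used.
-/

/-! ### Full rank -/

section Rank

variable {ι κ : Type*} [Fintype κ]

theorem mulVec_surjective_of_rank_eq [Fintype ι] {M : Matrix ι κ ℝ} (h : M.rank = Fintype.card ι) :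
    Function.Surjective M.mulVec := by
  have h1 : LinearMap.range M.mulVecLin = ⊤ :=
    Submodule.eq_top_of_finrank_eq (by rw [Module.finrank_fintype_fun_eq_card]; exact h)
  exact LinearMap.range_eq_top.mp h1

theorem mulVec_injective_of_rank_eq {M : Matrix ι κ ℝ} (h : M.rank = Fintype.card κ) :
    Function.Injective M.mulVec := by
  have h1 := LinearMap.finrank_range_add_finrank_ker M.mulVecLin
  rw [Module.finrank_fintype_fun_eq_card] at h1
  have h2 : Module.finrank ℝ (LinearMap.range M.mulVecLin) = Fintype.card κ := h
  have h3 : LinearMap.ker M.mulVecLin = ⊥ := Submodule.finrank_eq_zero.mp (by omega)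
  exact LinearMap.ker_eq_bot.mp h3

theorem mulVec_surjective_of_vecMul_eq_zero [Fintype ι] {M : Matrix ι κ ℝ}
    (h : ∀ v : ι → ℝ, v ᵥ* M = 0 → v = 0) : Function.Surjective M.mulVec := by
  apply mulVec_surjective_of_rank_eq
  rw [← Matrix.rank_transpose]
  have hinj : Function.Injective Mᵀ.mulVecLin := by
    rw [injective_iff_map_eq_zero]
    intro v hv
    exact h v (by simpa [Matrix.mulVec_transpose] using hv)
  have := LinearMap.finrank_range_of_inj hinj
  rwa [Module.finrank_fintype_fun_eq_card] at this

end Rank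

/-! ### Combinations of data windows -/

/-- The linear combination, with weights `α`, of the windows of `w` starting at `0, …, c - 1`:
a signal whose sample at time `t` is `∑ j, α j • w (t + j)`. -/
def slide {σ : Type*} {c : ℕ} (α : Fin c → ℝ) (w : ℕ → σ → ℝ) (t : ℕ) : σ → ℝ :=
  ∑ j, α j • w (t + j)

theorem hankel_mulVec {σ : Type*} {L c : ℕ} (w : ℕ → σ → ℝ) (α : Fin c → ℝ) :
    hankel L c w *ᵥ α = stack L (slide α w) := by
  ext i
  simp [hankel, stack, slide, Matrix.mulVec, dotProduct, mul_comm]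

theorem dataMatrix_mulVec {σ : Type*} {s N : ℕ} (w : ℕ → σ → ℝ) (α : Fin N → ℝ) :
    dataMatrix s N w *ᵥ α = slide α w s := by
  ext i
  simp [dataMatrix, slide, Matrix.mulVec, dotProduct, mul_comm]

theorem stack_inj {σ : Type*} {L : ℕ} {v w : ℕ → σ → ℝ} :
    stack L v = stack L w ↔ ∀ i < L, v i = w i := by
  constructor
  · intro h i hi
    ext b
    exact congrFun h (⟨i, hi⟩, b)
  · intro h
    ext ⟨i, b⟩
    exact congrFun (h i i.2) b

theorem ioWindow_inj {m p n : ℕ} {u u' : ℕ → Fin m → ℝ} {y y' : ℕ → Fin p → ℝ} {j j' : ℕ} :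
    ioWindow n u y j = ioWindow n u' y' j' ↔
      ∀ i < n, u (j + i) = u' (j' + i) ∧ y (j + i) = y' (j' + i) := by
  simp only [ioWindow, Sum.elim_eq_iff, stack_inj]
  exact ⟨fun h i hi => ⟨h.1 i hi, h.2 i hi⟩,
    fun h => ⟨fun i hi => (h i hi).1, fun i hi => (h i hi).2⟩⟩

theorem hankelEq_iff {m p n L N : ℕ} {ud : ℕ → Fin m → ℝ} {yd : ℕ → Fin p → ℝ}
    {α : Fin (N + 1 - (L + n)) → ℝ} {ub : ℕ → Fin m → ℝ} {yb : ℕ → Fin p → ℝ} :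
    HankelEq n L N ud yd α ub yb ↔
      ∀ i < L + n, slide α ud i = ub i ∧ slide α yd i = yb i := by
  simp only [HankelEq, Matrix.fromRows_mulVec, hankel_mulVec, Sum.elim_eq_iff, stack_inj]
  exact ⟨fun h i hi => ⟨h.1 i hi, h.2 i hi⟩,
    fun h => ⟨fun i hi => (h i hi).1, fun i hi => (h i hi).2⟩⟩

theorem regressor_mulVec {m n N : ℕ} {σ : Type*} (ud : ℕ → Fin m → ℝ) (ξ : ℕ → σ → ℝ)
    (α : Fin N → ℝ) :
    regressor n N ud ξ *ᵥ α = Sum.elim (slide α ud n) (slide α ξ n) := by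
  simp only [regressor, Matrix.fromRows_mulVec, dataMatrix_mulVec]

theorem slide_nonMinData {m p n N : ℕ} (ud : ℕ → Fin m → ℝ) (yd : ℕ → Fin p → ℝ)
    (α : Fin N → ℝ) (k : ℕ) :
    slide α (nonMinData n ud yd) (n + k) = ioWindow n (slide α ud) (slide α yd) k := by
  ext i
  have h (j : ℕ) : n + k + j - n = k + j := by omega
  rcases i with ⟨i, b⟩ | ⟨i, b⟩ <;>
    simp [slide, nonMinData, ioWindow, stack, h, add_right_comm]

/-- Weights on the first `c` windows may be regarded as weights on `N ≥ c` windows. -/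
theorem exists_slide_eq_of_le {c N : ℕ} (h : c ≤ N) (α : Fin c → ℝ) :
    ∃ a : Fin N → ℝ, ∀ (σ : Type) (w : ℕ → σ → ℝ) (t : ℕ), slide a w t = slide α w t := by
  refine ⟨fun j => if hj : (j : ℕ) < c then α ⟨j, hj⟩ else 0, fun σ w t => ?_⟩
  obtain ⟨d, rfl⟩ := Nat.exists_eq_add_of_le h
  simp [slide, Fin.sum_univ_add]

/-! ### Trajectories, controllability, observability -/

namespace LTISystem

variable {n m p : ℕ} {P : LTISystem n m p}

theorem IsStateTrajectory.mono {T T' : ℕ} {u : ℕ → Fin m → ℝ} {x : ℕ → Fin n → ℝ}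
    {y : ℕ → Fin p → ℝ} (h : P.IsStateTrajectory T u x y) (hT : T' ≤ T) :
    P.IsStateTrajectory T' u x y :=
  fun k hk => h k (by omega)

/-- Superposition and time invariance: combinations of shifted data are trajectories, as long as all
shifts stay within the data. -/
theorem IsStateTrajectory.slide_data {T T' c : ℕ} {u : ℕ → Fin m → ℝ} {x : ℕ → Fin n → ℝ}
    {y : ℕ → Fin p → ℝ} (h : P.IsStateTrajectory T u x y) (α : Fin c → ℝ)
    (hT : ∀ t < T', ∀ j < c, t + j < T) :
    P.IsStateTrajectory T' (slide α u) (slide α x) (slide α y) := by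
  intro t ht
  simp only [slide, Matrix.mulVec_sum, Matrix.mulVec_smul, ← Finset.sum_add_distrib,
    ← smul_add]
  constructor <;> refine Finset.sum_congr rfl fun j _ => ?_
  · rw [add_right_comm, (h _ (hT t ht j j.2)).1]
  · rw [(h _ (hT t ht j j.2)).2]

/-- The states that the system runs through from the initial state `x₀` under the inputs `u`. -/
def response (P : LTISystem n m p) (x₀ : Fin n → ℝ) (u : ℕ → Fin m → ℝ) : ℕ → Fin n → ℝ
  | 0 => x₀
  | k + 1 => P.A *ᵥ response P x₀ u k + P.B *ᵥ u k

/-- The outputs that belong to `LTISystem.response`. -/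
def output (P : LTISystem n m p) (x₀ : Fin n → ℝ) (u : ℕ → Fin m → ℝ) (k : ℕ) : Fin p → ℝ :=
  P.C *ᵥ P.response x₀ u k + P.D *ᵥ u k

theorem isStateTrajectory_response (P : LTISystem n m p) (T : ℕ) (x₀ : Fin n → ℝ)
    (u : ℕ → Fin m → ℝ) : P.IsStateTrajectory T u (P.response x₀ u) (P.output x₀ u) :=
  fun _ _ => ⟨rfl, rfl⟩

/-- A trajectory is determined by its initial state and its inputs. -/
theorem IsStateTrajectory.eq_response {T : ℕ} {u u' : ℕ → Fin m → ℝ} {x : ℕ → Fin n → ℝ}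
    {y : ℕ → Fin p → ℝ} (h : P.IsStateTrajectory T u x y) (hu : ∀ k < T, u k = u' k) :
    (∀ k ≤ T, x k = P.response (x 0) u' k) ∧ ∀ k < T, y k = P.output (x 0) u' k := by
  have hx : ∀ k ≤ T, x k = P.response (x 0) u' k := by
    intro k
    induction k with
    | zero => intro _; rfl
    | succ k ih =>
      intro hk
      rw [(h k hk).1, ih (by omega), hu k hk]
      rfl
  refine ⟨hx, fun k hk => ?_⟩
  rw [(h k hk).2, hx k hk.le, hu k hk]
  rfl

theorem response_eq_add (P : LTISystem n m p) (x₀ : Fin n → ℝ) (u : ℕ → Fin m → ℝ) (k : ℕ) :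
    P.response x₀ u k = P.A ^ k *ᵥ x₀ + P.response 0 u k := by
  induction k with
  | zero => simp [response]
  | succ k ih =>
    rw [response, ih, response, pow_succ', Matrix.mulVec_add, Matrix.mulVec_mulVec, add_assoc]

theorem response_zero_eq_sum (P : LTISystem n m p) (u : ℕ → Fin m → ℝ) (k : ℕ) :
    P.response 0 u k = ∑ t ∈ Finset.range k, (P.A ^ t * P.B) *ᵥ u (k - 1 - t) := by
  induction k with
  | zero => simp [response]
  | succ k ih =>
    rw [response, ih, Finset.sum_range_succ', Matrix.mulVec_sum]
    congr 1
    · refine Finset.sum_congr rfl fun t _ => ?_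
      rw [Matrix.mulVec_mulVec, pow_succ', Matrix.mul_assoc,
        show k + 1 - 1 - (t + 1) = k - 1 - t by omega]
    · simp

theorem ctrbMatrix_mulVec (P : LTISystem n m p) (w : Fin n × Fin m → ℝ) :
    P.ctrbMatrix *ᵥ w = ∑ t : Fin n, (P.A ^ (t : ℕ) * P.B) *ᵥ fun b => w (t, b) := by
  ext i
  simp [ctrbMatrix, Matrix.mulVec, dotProduct, Fintype.sum_prod_type]

/-- A controllable system reaches every state from `0` in `n` steps. -/
theorem Controllable.exists_response_eq (h : P.Controllable) (x₁ : Fin n → ℝ) :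
    ∃ u, P.response 0 u n = x₁ := by
  obtain ⟨w, hw⟩ := mulVec_surjective_of_rank_eq (M := P.ctrbMatrix)
    (by rw [h, Fintype.card_fin]) x₁
  refine ⟨fun t b => if ht : n - 1 - t < n then w (⟨n - 1 - t, ht⟩, b) else 0, ?_⟩
  rw [response_zero_eq_sum, ← hw]
  rw [ctrbMatrix_mulVec, Finset.sum_range]
  refine Finset.sum_congr rfl fun t _ => ?_
  have h1 : n - 1 - (n - 1 - (t : ℕ)) = t := by omega
  simp [h1]

theorem Controllable.eq_zero_of_vecMul (h : P.Controllable) (ξ : Fin n → ℝ)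
    (hξ : ∀ t < n, ξ ᵥ* (P.A ^ t * P.B) = 0) : ξ = 0 := by
  obtain ⟨u, hu⟩ := h.exists_response_eq ξ
  have : ξ ⬝ᵥ P.response 0 u n = 0 := by
    rw [response_zero_eq_sum, dotProduct_sum]
    refine Finset.sum_eq_zero fun t ht => ?_
    rw [Matrix.dotProduct_mulVec, hξ t (Finset.mem_range.mp ht), zero_dotProduct]
  rw [hu] at this
  exact dotProduct_self_eq_zero.mp this

theorem obsvMatrix_mulVec (P : LTISystem n m p) (x : Fin n → ℝ) :
    P.obsvMatrix *ᵥ x = stack n fun k => P.C *ᵥ (P.A ^ k *ᵥ x) := by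
  ext i
  simp only [stack, Matrix.mulVec_mulVec]
  rfl

theorem output_eq_add (P : LTISystem n m p) (x₀ : Fin n → ℝ) (u : ℕ → Fin m → ℝ) (k : ℕ) :
    P.output x₀ u k = P.C *ᵥ (P.A ^ k *ᵥ x₀) + P.output 0 u k := by
  rw [output, response_eq_add, Matrix.mulVec_add, add_assoc, output]

/-- Observability: inputs and outputs that vanish over `n` steps come from the initial state `0`. -/
theorem Observable.initial_eq_zero (h : P.Observable) {u : ℕ → Fin m → ℝ} {x : ℕ → Fin n → ℝ}
    {y : ℕ → Fin p → ℝ} (hx : P.IsStateTrajectory n u x y) (hu : ∀ k < n, u k = 0)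
    (hy : ∀ k < n, y k = 0) : x 0 = 0 := by
  have h0 (k : ℕ) : P.response 0 (fun _ => 0) k = 0 := by
    rw [response_zero_eq_sum]; simp
  apply mulVec_injective_of_rank_eq (M := P.obsvMatrix) (by rw [h, Fintype.card_fin])
  rw [Matrix.mulVec_zero, obsvMatrix_mulVec]
  ext ⟨k, b⟩
  have h1 := (hx.eq_response (u' := fun _ => 0) hu).2 k k.2
  rw [hy k k.2, output_eq_add, output, h0] at h1
  simpa [stack] using congrFun h1.symm b

/-- With a single output the observability matrix is square, so that an observable system has no
constraint on the inputs and outputs of `n` consecutive steps. -/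
theorem Observable.isTrajectory_of_single_output (h : P.Observable) (hp : p = 1)
    (u : ℕ → Fin m → ℝ) (y : ℕ → Fin p → ℝ) : P.IsTrajectory n u y := by
  obtain ⟨x₀, hx₀⟩ := mulVec_surjective_of_rank_eq (M := P.obsvMatrix) (by rw [h]; simp [hp])
    (stack n fun k => y k - P.output 0 u k)
  rw [obsvMatrix_mulVec, stack_inj] at hx₀
  refine ⟨P.response x₀ u, fun k hk => ⟨rfl, ?_⟩⟩
  have h1 := P.output_eq_add x₀ u k
  rw [hx₀ k hk, sub_add_cancel] at h1
  exact h1.symm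

end LTISystem

/-! ### The fundamental lemma -/

/-- Persistently exciting inputs have, among the combinations of their windows of length `M`,
every signal of length `M`. -/
theorem PersistentlyExciting.exists_slide_eq {q M N : ℕ} {w : ℕ → Fin q → ℝ}
    (h : PersistentlyExciting M N w) (v : ℕ → Fin q → ℝ) :
    ∃ α : Fin (N + 1 - M) → ℝ, ∀ i < M, slide α w i = v i := by
  obtain ⟨α, hα⟩ := mulVec_surjective_of_rank_eq (M := hankel M (N + 1 - M) w)
    (by rw [h]; simp [mul_comm]) (stack M v)
  exact ⟨α, stack_inj.mp ((hankel_mulVec w α).symm.trans hα)⟩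

/-- A functional that vanishes on all windows of a persistently exciting input is zero. -/
theorem PersistentlyExciting.eq_zero_of_sum_dotProduct {q M N : ℕ} {w : ℕ → Fin q → ℝ}
    (h : PersistentlyExciting M N w) (f : ℕ → Fin q → ℝ)
    (hf : ∀ j < N + 1 - M, ∑ t ∈ Finset.range M, f t ⬝ᵥ w (j + t) = 0) :
    ∀ t < M, f t = 0 := by
  obtain ⟨α, hα⟩ := h.exists_slide_eq f
  have h0 : ∑ t ∈ Finset.range M, f t ⬝ᵥ slide α w t = 0 := by
    simp only [slide, dotProduct_sum, dotProduct_smul]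
    rw [Finset.sum_comm]
    refine Finset.sum_eq_zero fun j _ => ?_
    rw [← Finset.smul_sum]
    simp only [add_comm _ (j : ℕ)]
    rw [hf j j.2, smul_zero]
  rw [Finset.sum_congr rfl fun t ht => by rw [hα t (Finset.mem_range.mp ht)],
    Finset.sum_eq_zero_iff_of_nonneg fun t _ =>
      show 0 ≤ f t ⬝ᵥ f t from Finset.sum_nonneg fun b _ => mul_self_nonneg (f t b)] at h0
  exact fun t ht => dotProduct_self_eq_zero.mp (h0 t (Finset.mem_range.mpr ht))

namespace LTISystem

variable {n m p : ℕ} {P : LTISystem n m p}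

/-- The row vectors `η_{K-1}, …, η_0, ξ B, ξ A B, ξ A² B, …`. -/
def kernelCoeff (P : LTISystem n m p) (ξ : Fin n → ℝ) (K : ℕ) (η : ℕ → Fin m → ℝ) (i : ℕ) :
    Fin m → ℝ :=
  if i < K then η (K - 1 - i) else ξ ᵥ* (P.A ^ (i - K) * P.B)

/-- The functional `(x, u) ↦ ξ · x_0 + ∑_{i<K} η_i · u_i`, evaluated on a trajectory `s` steps later
and rewritten in terms of `x_0` and `u_0, …, u_{K+s-1}`, has the coefficients `ξ A^s` and,
at `u_t`, this one. -/
def shiftedCoeff (P : LTISystem n m p) (ξ : Fin n → ℝ) (K : ℕ) (η : ℕ → Fin m → ℝ) (s t : ℕ) :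
    Fin m → ℝ :=
  if K + s ≤ t then 0 else P.kernelCoeff ξ K η (K + s - 1 - t)

theorem sum_shiftedCoeff {T K : ℕ} {u : ℕ → Fin m → ℝ} {x : ℕ → Fin n → ℝ} {y : ℕ → Fin p → ℝ}
    (h : P.IsStateTrajectory T u x y) (ξ : Fin n → ℝ) (η : ℕ → Fin m → ℝ) (s : ℕ) :
    ∀ j, j + s ≤ T →
      ξ ⬝ᵥ x (j + s) + ∑ i ∈ Finset.range K, η i ⬝ᵥ u (j + s + i) =
        (ξ ᵥ* P.A ^ s) ⬝ᵥ x j +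
          ∑ t ∈ Finset.range (K + s), P.shiftedCoeff ξ K η s t ⬝ᵥ u (j + t) := by
  induction s with
  | zero =>
    intro j _
    simp only [add_zero, pow_zero, Matrix.vecMul_one, add_right_inj]
    refine Finset.sum_congr rfl fun t ht => ?_
    have ht := Finset.mem_range.mp ht
    rw [shiftedCoeff, if_neg (by omega), kernelCoeff, if_pos (by omega),
      show K - 1 - (K + 0 - 1 - t) = t by omega]
  | succ s ih =>
    intro j hj
    have h1 := ih (j + 1) (by omega)
    have h2 (t : ℕ) : P.shiftedCoeff ξ K η (s + 1) (t + 1) = P.shiftedCoeff ξ K η s t := by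
      simp only [shiftedCoeff, show K + (s + 1) ≤ t + 1 ↔ K + s ≤ t by omega,
        show K + (s + 1) - 1 - (t + 1) = K + s - 1 - t by omega]
    have h3 : P.shiftedCoeff ξ K η (s + 1) 0 = ξ ᵥ* (P.A ^ s * P.B) := by
      rw [shiftedCoeff, if_neg (by omega), kernelCoeff, if_neg (by omega),
        show K + (s + 1) - 1 - 0 - K = s by omega]
    rw [show j + (s + 1) = j + 1 + s by omega, h1, (h j (by omega)).1, ← add_assoc K s 1,
      Finset.sum_range_succ', dotProduct_add, h3]
    simp only [h2, add_zero, pow_succ, ← Matrix.vecMul_vecMul, Matrix.dotProduct_mulVec,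
      add_assoc j 1, add_comm 1]
    ring

/-- The heart of the fundamental lemma: a functional of the state and of the next `K` inputs that
vanishes along the data is zero. By Cayley–Hamilton, the combination of its shifts with the
coefficients of the characteristic polynomial of `A` involves `K + n` inputs and no state, so that
persistency of excitation makes it vanish; as that polynomial is monic, this gives a recursion which
forces the coefficients `η_{K-1}, …, η_0, ξ B, ξ A B, …` to be zero one after the other. -/
theorem Controllable.functional_eq_zero {T K N : ℕ} {u : ℕ → Fin m → ℝ} {x : ℕ → Fin n → ℝ}
    {y : ℕ → Fin p → ℝ} (hP : P.Controllable) (h : P.IsStateTrajectory T u x y) (hT : N ≤ T)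
    (hu : PersistentlyExciting (K + n) N u) (ξ : Fin n → ℝ) (η : ℕ → Fin m → ℝ)
    (h0 : ∀ j < N + 1 - K, ξ ⬝ᵥ x j + ∑ i ∈ Finset.range K, η i ⬝ᵥ u (j + i) = 0) :
    ξ = 0 ∧ ∀ i < K, η i = 0 := by
  set c : ℕ → ℝ := fun s => P.A.charpoly.coeff s with hc
  have hdeg : P.A.charpoly.natDegree = n := by
    rw [Matrix.charpoly_natDegree_eq_dim, Fintype.card_fin]
  have hlead : c n = 1 := by
    have := P.A.charpoly_monic.coeff_natDegree
    rwa [hdeg] at this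
  have hCH : ∑ s ∈ Finset.range (n + 1), c s • P.A ^ s = 0 := by
    have := P.A.aeval_self_charpoly
    rwa [Polynomial.aeval_eq_sum_range, hdeg] at this
  -- the combination of the shifts has no state part, so excitation makes its input part vanish
  have hcomb : ∀ t < K + n, ∑ s ∈ Finset.range (n + 1), c s • P.shiftedCoeff ξ K η s t = 0 := by
    refine hu.eq_zero_of_sum_dotProduct _ fun j hj => ?_
    have hs : ∀ s ∈ Finset.range (n + 1),
        c s * ((ξ ᵥ* P.A ^ s) ⬝ᵥ x j +
          ∑ t ∈ Finset.range (K + n), P.shiftedCoeff ξ K η s t ⬝ᵥ u (j + t)) = 0 := by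
      intro s hs
      have hs := Finset.mem_range.mp hs
      have hext : ∑ t ∈ Finset.range (K + n), P.shiftedCoeff ξ K η s t ⬝ᵥ u (j + t) =
          ∑ t ∈ Finset.range (K + s), P.shiftedCoeff ξ K η s t ⬝ᵥ u (j + t) := by
        symm
        refine Finset.sum_subset (Finset.range_mono (by omega)) fun t _ ht => ?_
        rw [shiftedCoeff, if_pos (by simpa using ht), zero_dotProduct]
      rw [hext, ← sum_shiftedCoeff h ξ η s j (by omega), h0 (j + s) (by omega), mul_zero]
    have hsum := Finset.sum_eq_zero hs
    simp only [mul_add, Finset.sum_add_distrib] at hsum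
    have hx : ∑ s ∈ Finset.range (n + 1), c s * ((ξ ᵥ* P.A ^ s) ⬝ᵥ x j) = 0 := by
      have : (ξ ᵥ* ∑ s ∈ Finset.range (n + 1), c s • P.A ^ s) ⬝ᵥ x j = 0 := by
        rw [hCH, Matrix.vecMul_zero, zero_dotProduct]
      simpa only [Matrix.vecMul_sum, Matrix.vecMul_smul, sum_dotProduct, smul_dotProduct,
        smul_eq_mul] using this
    rw [hx, zero_add] at hsum
    simp only [Finset.mul_sum] at hsum
    rw [Finset.sum_comm] at hsum
    simpa only [sum_dotProduct, smul_dotProduct, smul_eq_mul] using hsum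
  -- the term `s = n` of the combination at `t = K + n - 1 - i` is coefficient `i`, as the polynomial
  -- is monic; the other terms are coefficients with smaller indices
  have hzero : ∀ i, i < K + n → P.kernelCoeff ξ K η i = 0 := by
    intro i
    induction i using Nat.strong_induction_on with
    | _ i ih =>
      intro hi
      have h1 := hcomb (K + n - 1 - i) (by omega)
      rw [Finset.sum_range_succ, hlead, one_smul, Finset.sum_eq_zero, zero_add, shiftedCoeff,
        if_neg (by omega), show K + n - 1 - (K + n - 1 - i) = i by omega] at h1
      · exact h1
      · intro s hs
        have hs := Finset.mem_range.mp hs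
        rw [shiftedCoeff]
        split_ifs with hle
        · exact smul_zero _
        · rw [ih _ (by omega) (by omega), smul_zero]
  constructor
  · refine hP.eq_zero_of_vecMul ξ fun t ht => ?_
    have := hzero (K + t) (by omega)
    rwa [kernelCoeff, if_neg (by omega), Nat.add_sub_cancel_left] at this
  · intro i hi
    have := hzero (K - 1 - i) (by omega)
    rwa [kernelCoeff, if_pos (by omega), show K - 1 - (K - 1 - i) = i by omega] at this

/-- The fundamental lemma of Willems et al.: if the inputs are persistently exciting of order
`K + n`, the data windows combine to any initial state and any `K` inputs. -/
theorem Controllable.exists_slide_eq {T K N : ℕ} {u : ℕ → Fin m → ℝ} {x : ℕ → Fin n → ℝ}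
    {y : ℕ → Fin p → ℝ} (hP : P.Controllable) (h : P.IsStateTrajectory T u x y) (hT : N ≤ T)
    (hu : PersistentlyExciting (K + n) N u) (x₀ : Fin n → ℝ) (v : ℕ → Fin m → ℝ) :
    ∃ α : Fin (N + 1 - K) → ℝ, slide α x 0 = x₀ ∧ ∀ i < K, slide α u i = v i := by
  have hsurj : Function.Surjective
      (Matrix.fromRows (hankel K (N + 1 - K) u) (dataMatrix 0 (N + 1 - K) x)).mulVec := by
    refine mulVec_surjective_of_vecMul_eq_zero fun w hw => ?_
    set η : ℕ → Fin m → ℝ := fun i b => if hi : i < K then w (Sum.inl (⟨i, hi⟩, b)) else 0 with hη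
    obtain ⟨h1, h2⟩ := hP.functional_eq_zero h hT hu (fun b => w (Sum.inr b)) η (by
      intro j hj
      have := congrFun hw ⟨j, hj⟩
      simpa [Matrix.vecMul, dotProduct, hankel, dataMatrix, Fintype.sum_prod_type,
        Finset.sum_range, hη, add_comm] using this)
    ext (⟨i, b⟩ | b)
    · simpa [hη] using congrFun (h2 i i.2) b
    · exact congrFun h1 b
  obtain ⟨α, hα⟩ := hsurj (Sum.elim (stack K v) x₀)
  simp only [Matrix.fromRows_mulVec, hankel_mulVec, dataMatrix_mulVec, Sum.elim_eq_iff,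
    stack_inj] at hα
  exact ⟨α, hα.2, hα.1⟩

end LTISystem

namespace LTISystem

variable {n m p : ℕ} {P : LTISystem n m p}

/-- Whatever solves the Hankel equation is a trajectory, with the combined data states. -/
theorem IsStateTrajectory.of_hankelEq {L N : ℕ} {ud ub : ℕ → Fin m → ℝ}
    {xd : ℕ → Fin n → ℝ} {yd yb : ℕ → Fin p → ℝ} (h : P.IsStateTrajectory (N + n) ud xd yd)
    {α : Fin (N + 1 - (L + n)) → ℝ} (hα : HankelEq n L N ud yd α ub yb) :
    P.IsStateTrajectory (L + n) ub (slide α xd) yb := by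
  rw [hankelEq_iff] at hα
  intro k hk
  rw [← (hα k hk).1, ← (hα k hk).2]
  exact h.slide_data α (T' := L + n) (by omega) k hk

/-- Under persistency of excitation every trajectory of length `L + n` is a combination of the data
windows; the states combine with the same weights, one step further than inputs and outputs. -/
theorem Controllable.exists_hankelEq {L N : ℕ} {ud ub : ℕ → Fin m → ℝ}
    {xd x : ℕ → Fin n → ℝ} {yd yb : ℕ → Fin p → ℝ} (hP : P.Controllable)
    (h : P.IsStateTrajectory (N + n) ud xd yd) (hu : PersistentlyExciting (L + 2 * n) N ud)
    (hx : P.IsStateTrajectory (L + n) ub x yb) :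
    ∃ α, HankelEq n L N ud yd α ub yb ∧ ∀ k ≤ L + n, slide α xd k = x k := by
  obtain ⟨α, hα0, hαu⟩ := hP.exists_slide_eq (K := L + n) (N := N) h (by omega)
    (by rwa [show L + n + n = L + 2 * n by ring]) (x 0) ub
  have h1 := (h.slide_data α (T' := L + n) (by omega)).eq_response (u' := ub) hαu
  have h2 := hx.eq_response (u' := ub) fun _ _ => rfl
  rw [hα0] at h1
  exact ⟨α, hankelEq_iff.mpr fun i hi => ⟨hαu i hi, (h1.2 i hi).trans (h2.2 i hi).symm⟩,
    fun k hk => (h1.1 k hk).trans (h2.1 k hk).symm⟩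

end LTISystem

/-! ### The data-based one-step predictor -/

/-- The one-step predictor does not depend on the chosen generalized inverse: on the range of the
regressor it maps a combination of the data to the same combination one step later, as soon as
combinations with zero regressor have a zero successor. -/
theorem predictor_mulVec_regressor {m n N : ℕ} {σ : Type*} [Fintype σ] {ud : ℕ → Fin m → ℝ}
    {ξ : ℕ → σ → ℝ} {G : Matrix (Fin N) (Fin m ⊕ σ) ℝ} (hG : IsGenInverse (regressor n N ud ξ) G)
    (h0 : ∀ b : Fin N → ℝ, slide b ud n = 0 → slide b ξ n = 0 → slide b ξ (n + 1) = 0)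
    (a : Fin N → ℝ) :
    (dataMatrix (n + 1) N ξ * G) *ᵥ Sum.elim (slide a ud n) (slide a ξ n) = slide a ξ (n + 1) := by
  rw [← regressor_mulVec, ← Matrix.mulVec_mulVec, ← dataMatrix_mulVec (s := n + 1), ← sub_eq_zero,
    ← Matrix.mulVec_sub, dataMatrix_mulVec]
  have h1 : regressor n N ud ξ *ᵥ (G *ᵥ (regressor n N ud ξ *ᵥ a) - a) = 0 := by
    rw [Matrix.mulVec_sub, Matrix.mulVec_mulVec, Matrix.mulVec_mulVec, hG, sub_self]
  rw [regressor_mulVec, ← Sum.elim_zero_zero, Sum.elim_eq_iff] at h1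
  exact h0 _ h1.1 h1.2

namespace LTISystem

section State

variable {n m p : ℕ} {P : LTISystem n m p}

/-- Input and state at time `n` take all values among the combinations of the data. -/
theorem Controllable.exists_slide_eq_at {L N : ℕ} (hL : 1 ≤ L) (hn : 1 ≤ n) {ud : ℕ → Fin m → ℝ}
    {xd : ℕ → Fin n → ℝ} {yd : ℕ → Fin p → ℝ} (hP : P.Controllable)
    (h : P.IsStateTrajectory (N + n) ud xd yd) (hu : PersistentlyExciting (L + 2 * n) N ud)
    (u₁ : Fin m → ℝ) (x₁ : Fin n → ℝ) :
    ∃ a : Fin N → ℝ, slide a ud n = u₁ ∧ slide a xd n = x₁ := by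
  obtain ⟨v, hv⟩ := hP.exists_response_eq x₁
  set w : ℕ → Fin m → ℝ := fun i => if i < n then v i else u₁ with hw
  obtain ⟨α, hα, hx⟩ := hP.exists_hankelEq h hu (P.isStateTrajectory_response (L + n) 0 w)
  obtain ⟨a, ha⟩ := exists_slide_eq_of_le (by omega : N + 1 - (L + n) ≤ N) α
  refine ⟨a, ?_, ?_⟩
  · rw [ha, (hankelEq_iff.mp hα n (by omega)).1, hw]
    simp
  · rw [ha, hx n (by omega), ← hv]
    exact (((P.isStateTrajectory_response n 0 w).eq_response (u' := v)
      fun k hk => if_pos hk).1 n le_rfl)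

theorem Controllable.exists_regressor_rightInverse {L N : ℕ} (hL : 1 ≤ L) (hn : 1 ≤ n)
    {ud : ℕ → Fin m → ℝ} {xd : ℕ → Fin n → ℝ} {yd : ℕ → Fin p → ℝ} (hP : P.Controllable)
    (h : P.IsStateTrajectory (N + n) ud xd yd) (hu : PersistentlyExciting (L + 2 * n) N ud) :
    ∃ R : Matrix (Fin N) (Fin m ⊕ Fin n) ℝ, regressor n N ud xd * R = 1 := by
  refine Matrix.mulVec_surjective_iff_exists_right_inverse.mp fun v => ?_
  obtain ⟨a, h1, h2⟩ := hP.exists_slide_eq_at hL hn h hu (v ∘ Sum.inl) (v ∘ Sum.inr)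
  exact ⟨a, by rw [regressor_mulVec, h1, h2, Sum.elim_comp_inl_inr]⟩

/-- With measured states the data-based predictor is the state equation. -/
theorem Controllable.predictor_state {L N : ℕ} (hL : 1 ≤ L) (hn : 1 ≤ n) {ud : ℕ → Fin m → ℝ}
    {xd : ℕ → Fin n → ℝ} {yd : ℕ → Fin p → ℝ} (hP : P.Controllable)
    (h : P.IsStateTrajectory (N + n) ud xd yd) (hu : PersistentlyExciting (L + 2 * n) N ud)
    {G : Matrix (Fin N) (Fin m ⊕ Fin n) ℝ} (hG : IsGenInverse (regressor n N ud xd) G)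
    (u₁ : Fin m → ℝ) (x₁ : Fin n → ℝ) :
    (dataMatrix (n + 1) N xd * G) *ᵥ Sum.elim u₁ x₁ = P.A *ᵥ x₁ + P.B *ᵥ u₁ := by
  obtain ⟨a, rfl, rfl⟩ := hP.exists_slide_eq_at hL hn h hu u₁ x₁
  have hstep (b : Fin N → ℝ) := (h.slide_data b (T' := n + 1) (by omega) n (by omega)).1
  rw [predictor_mulVec_regressor hG (fun b h1 h2 => by rw [hstep, h1, h2]; simp), hstep]

/-- A trajectory of length `n` that ends in the state `xb 0`, followed by `xb 0, …, xb L` obeying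
the state equation, is the response to the concatenated inputs. -/
theorem response_concat {L : ℕ} {u ub : ℕ → Fin m → ℝ} {x₀ : Fin n → ℝ} {xb : ℕ → Fin n → ℝ}
    (h0 : P.response x₀ u n = xb 0) (hub : ∀ k < L, u (n + k) = ub k)
    (hxb : ∀ k < L, xb (k + 1) = P.A *ᵥ xb k + P.B *ᵥ ub k) :
    ∀ k ≤ L, P.response x₀ u (n + k) = xb k := by
  intro k
  induction k with
  | zero => exact fun _ => h0
  | succ k ih =>
    intro hk
    rw [← add_assoc, response, ih (by omega), hub k hk, hxb k hk]

end State

section NonMinimal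

variable {n m p : ℕ} {P : LTISystem n m p}

/-- Along every trajectory the data-based predictor maps an input and a non-minimal state to the
next non-minimal state. -/
theorem Observable.predictor_nonMin {L N T k : ℕ} (hL : 1 ≤ L) (hn : 1 ≤ n) {ud u : ℕ → Fin m → ℝ}
    {xd x : ℕ → Fin n → ℝ} {yd y : ℕ → Fin p → ℝ} (hO : P.Observable) (hP : P.Controllable)
    (h : P.IsStateTrajectory (N + n) ud xd yd) (hu : PersistentlyExciting (L + 2 * n) N ud)
    {G : Matrix (Fin N) (Fin m ⊕ NonMin n m p) ℝ}
    (hG : IsGenInverse (regressor n N ud (nonMinData n ud yd)) G)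
    (hx : P.IsStateTrajectory T u x y) (hk : n + k < T) :
    (dataMatrix (n + 1) N (nonMinData n ud yd) * G) *ᵥ Sum.elim (u (n + k)) (ioWindow n u y k) =
      ioWindow n u y (k + 1) := by
  -- zero inputs and outputs come from a zero state, which has a zero next output
  have h0 : ∀ b : Fin N → ℝ, slide b ud n = 0 → slide b (nonMinData n ud yd) n = 0 →
      slide b (nonMinData n ud yd) (n + 1) = 0 := by
    intro b hbu hbz
    have hb := h.slide_data b (T' := n + 1) (by omega)
    have hz : ioWindow n (slide b ud) (slide b yd) 0 =
        ioWindow n (fun _ => 0) (fun _ => 0) 0 := by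
      rw [← slide_nonMinData, add_zero, hbz]
      ext (i | i) <;> rfl
    simp only [ioWindow_inj, zero_add] at hz
    have hu0 : ∀ k < n + 1, slide b ud k = 0 := by
      intro k hk
      rcases Nat.lt_succ_iff_lt_or_eq.mp hk with hk | rfl
      exacts [(hz k hk).1, hbu]
    have hx0 := hO.initial_eq_zero (hb.mono (Nat.le_succ n)) (fun k hk => (hz k hk).1)
      fun k hk => (hz k hk).2
    have hr := (hb.eq_response (u' := fun _ => 0) hu0).2
    have hy0 : ∀ k < n + 1, slide b yd k = 0 := by
      intro k hk
      rw [hr k hk, hx0, output, response_zero_eq_sum]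
      simp
    rw [slide_nonMinData]
    have : ioWindow n (slide b ud) (slide b yd) 1 =
        ioWindow n (fun _ => 0) (fun _ => 0) 1 :=
      ioWindow_inj.mpr fun i hi => ⟨hu0 _ (by omega), hy0 _ (by omega)⟩
    rw [this]
    ext (i | i) <;> rfl
  -- the `n + 1` samples from time `k` on, continued to a trajectory of length `L + n`
  have hsh : P.IsStateTrajectory (n + 1) (fun i => u (k + i)) (fun i => x (k + i))
      fun i => y (k + i) := fun i hi => hx (k + i) (by omega)
  have hy := (hsh.eq_response (u' := fun i => u (k + i)) fun _ _ => rfl).2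
  obtain ⟨α, hα, -⟩ := hP.exists_hankelEq h hu
    (P.isStateTrajectory_response (L + n) (x (k + 0)) fun i => u (k + i))
  obtain ⟨a, ha⟩ := exists_slide_eq_of_le (by omega : N + 1 - (L + n) ≤ N) α
  rw [hankelEq_iff] at hα
  have hau : ∀ i < n + 1, slide a ud i = u (k + i) := fun i hi => by
    rw [ha, (hα i (by omega)).1]
  have hay : ∀ i < n + 1, slide a yd i = y (k + i) := fun i hi => by
    rw [ha, (hα i (by omega)).2, ← hy i hi]
  have hz (j : ℕ) (hj : j < 2) : slide a (nonMinData n ud yd) (n + j) = ioWindow n u y (k + j) := by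
    rw [slide_nonMinData, ioWindow_inj]
    intro i hi
    rw [hau _ (by omega), hay _ (by omega), add_assoc]
    exact ⟨rfl, rfl⟩
  have := predictor_mulVec_regressor hG h0 a
  have hz0 := hz 0 (by omega)
  rw [add_zero, add_zero] at hz0
  rwa [hau n (by omega), add_comm k n, hz0, hz 1 (by omega)] at this

/-- With a single output every pair of input and non-minimal state occurs on a trajectory, hence among
the combinations of the data. -/
theorem Observable.exists_regressor_nonMin_rightInverse {L N : ℕ} (hL : 1 ≤ L) (hn : 1 ≤ n)
    {ud : ℕ → Fin m → ℝ} {xd : ℕ → Fin n → ℝ} {yd : ℕ → Fin p → ℝ} (hO : P.Observable)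
    (hP : P.Controllable) (h : P.IsStateTrajectory (N + n) ud xd yd)
    (hu : PersistentlyExciting (L + 2 * n) N ud) (hp : p = 1) :
    ∃ R : Matrix (Fin N) (Fin m ⊕ NonMin n m p) ℝ,
      regressor n N ud (nonMinData n ud yd) * R = 1 := by
  refine Matrix.mulVec_surjective_iff_exists_right_inverse.mp fun v => ?_
  set w : ℕ → Fin m → ℝ := fun i b =>
    if hi : i < n then v (Sum.inr (Sum.inl (⟨i, hi⟩, b))) else v (Sum.inl b) with hw
  set y : ℕ → Fin p → ℝ := fun i b =>
    if hi : i < n then v (Sum.inr (Sum.inr (⟨i, hi⟩, b))) else 0 with hy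
  obtain ⟨x, hx⟩ := hO.isTrajectory_of_single_output hp w y
  have hx' := (hx.eq_response (u' := w) fun _ _ => rfl).2
  obtain ⟨α, hα, -⟩ := hP.exists_hankelEq h hu (P.isStateTrajectory_response (L + n) (x 0) w)
  obtain ⟨a, ha⟩ := exists_slide_eq_of_le (by omega : N + 1 - (L + n) ≤ N) α
  rw [hankelEq_iff] at hα
  refine ⟨a, ?_⟩
  have hz := slide_nonMinData (n := n) ud yd a 0
  rw [add_zero] at hz
  rw [regressor_mulVec, hz, ha, (hα n (by omega)).1]
  have : ioWindow n (slide a ud) (slide a yd) 0 = ioWindow n w y 0 :=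
    ioWindow_inj.mpr fun i hi => by
      rw [zero_add, ha, ha, (hα i (by omega)).1, (hα i (by omega)).2, hx' i hi]
      exact ⟨rfl, rfl⟩
  rw [this]
  ext (b | ⟨i, b⟩ | ⟨i, b⟩) <;> simp [ioWindow, stack, hw, hy]

end NonMinimal

end LTISystem

/-! ### Equivalence of the models -/

namespace LTISystem

section State

variable {n m L N : ℕ} {P : LTISystem n m n}

/-- With `y = x` the outputs of a trajectory are its states. -/
theorem IsStateTrajectory.output_eq_state (hC : P.C = 1) (hD : P.D = 0) {T : ℕ}
    {u : ℕ → Fin m → ℝ} {x y : ℕ → Fin n → ℝ} (h : P.IsStateTrajectory T u x y) {k : ℕ}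
    (hk : k < T) : y k = x k := by
  rw [(h k hk).2, hC, hD, Matrix.one_mulVec, Matrix.zero_mulVec, add_zero]

/-- Equivalence of the models for measured states, from a given past. -/
theorem hankelModel_iff_state (hL : 1 ≤ L) (hn : 1 ≤ n) (hP : P.Controllable) (hC : P.C = 1)
    (hD : P.D = 0) {ud : ℕ → Fin m → ℝ} {xd yd : ℕ → Fin n → ℝ}
    (h : P.IsStateTrajectory (N + n) ud xd yd) (hu : PersistentlyExciting (L + 2 * n) N ud)
    {G : Matrix (Fin N) (Fin m ⊕ Fin n) ℝ} (hG : IsGenInverse (regressor n N ud xd) G)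
    (ub : ℕ → Fin m → ℝ) (yb : ℕ → Fin n → ℝ) :
    HankelModel n L N ud yd ub yb ↔
      (∃ x, P.IsStateTrajectory n ub x yb ∧ x n = yb n) ∧
      ∃ xb : ℕ → Fin n → ℝ, (∀ k < L, xb k = yb (n + k)) ∧
        EDDPCModel n L N xd G (fun k => ub (n + k)) xb := by
  have hpred := hP.predictor_state hL hn h hu hG
  constructor
  · rintro ⟨α, hα⟩
    have hx := h.of_hankelEq hα
    refine ⟨⟨slide α xd, hx.mono (by omega), (hx.output_eq_state hC hD (by omega)).symm⟩,
      fun k => slide α xd (n + k), fun k hk => (hx.output_eq_state hC hD (by omega)).symm,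
      fun k hk => ?_⟩
    rw [hpred]
    exact (hx (n + k) (by omega)).1
  · rintro ⟨⟨x, hx, hxn⟩, xb, hxb, hE⟩
    have hr := (hx.eq_response (u' := ub) fun _ _ => rfl).1
    have hc := P.response_concat (L := L) (u := ub) (x₀ := x 0) (xb := xb)
      (by rw [← hr n le_rfl, hxn, hxb 0 (by omega), add_zero]) (fun _ _ => rfl)
      fun k hk => by rw [hE k hk, hpred]
    have htraj : P.IsStateTrajectory (L + n) ub (P.response (x 0) ub) yb := by
      refine fun k hk => ⟨rfl, ?_⟩
      rw [hC, hD, Matrix.one_mulVec, Matrix.zero_mulVec, add_zero]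
      rcases lt_or_ge k n with hkn | hkn
      · rw [hx.output_eq_state hC hD hkn, hr k hkn.le]
      · obtain ⟨i, rfl⟩ := Nat.exists_eq_add_of_le hkn
        rw [hc i (by omega), hxb i (by omega)]
    obtain ⟨α, hα, -⟩ := hP.exists_hankelEq h hu htraj
    exact ⟨α, hα⟩

/-- Equivalence of the models for measured states, on the level of predicted sequences: by
controllability every initial state `xb 0` has a past. -/
theorem eddpcModel_iff_state (hL : 1 ≤ L) (hn : 1 ≤ n) (hP : P.Controllable) (hC : P.C = 1)
    (hD : P.D = 0) {ud : ℕ → Fin m → ℝ} {xd yd : ℕ → Fin n → ℝ}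
    (h : P.IsStateTrajectory (N + n) ud xd yd) (hu : PersistentlyExciting (L + 2 * n) N ud)
    {G : Matrix (Fin N) (Fin m ⊕ Fin n) ℝ} (hG : IsGenInverse (regressor n N ud xd) G)
    (ub : ℕ → Fin m → ℝ) (xb : ℕ → Fin n → ℝ) :
    EDDPCModel n L N xd G ub xb ↔
      ∃ α ub' yb', HankelEq n L N ud yd α ub' yb' ∧
        (∀ k < L, ub' (n + k) = ub k ∧ yb' (n + k) = xb k) ∧
        hankel L (N + 1 - (L + n)) (fun k => xd (n + 1 + k)) *ᵥ α =
          stack L (fun k => xb (1 + k)) := by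
  have hpred := hP.predictor_state hL hn h hu hG
  have hshift (α : Fin (N + 1 - (L + n)) → ℝ) (k : ℕ) :
      slide α (fun k => xd (n + 1 + k)) k = slide α xd (n + 1 + k) := by
    simp only [slide, add_assoc]
  simp only [hankel_mulVec, stack_inj, hshift]
  constructor
  · intro hE
    obtain ⟨v, hv⟩ := hP.exists_response_eq (xb 0)
    set w : ℕ → Fin m → ℝ := fun i => if i < n then v i else ub (i - n) with hw
    have hwub : ∀ k < L, w (n + k) = ub k := fun k _ => by simp [hw]
    have hc := P.response_concat (L := L) (u := w) (x₀ := 0) (xb := xb)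
      ((((P.isStateTrajectory_response n 0 w).eq_response (u' := v)
        fun k hk => if_pos hk).1 n le_rfl).trans hv) hwub
      fun k hk => by rw [hE k hk, hpred]
    have htraj := P.isStateTrajectory_response (L + n) 0 w
    obtain ⟨α, hα, hx⟩ := hP.exists_hankelEq h hu htraj
    refine ⟨α, w, _, hα, fun k hk => ⟨hwub k hk, ?_⟩, fun k hk => ?_⟩
    · rw [htraj.output_eq_state hC hD (by omega), hc k hk.le]
    · rw [hx _ (by omega), add_assoc, hc _ (by omega)]
  · rintro ⟨α, ub', yb', hα, hub, hxb⟩ k hk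
    have hx := h.of_hankelEq hα
    rw [hpred, add_comm k 1, ← hxb k hk, ← (hub k hk).1, ← (hub k hk).2,
      hx.output_eq_state hC hD (by omega), add_right_comm, (hx (n + k) (by omega)).1]

end State

section NonMinimal

variable {n m p L N : ℕ} {P : LTISystem n m p}

/-- Equivalence of the models for the non-minimal state, from a given past. -/
theorem hankelModel_iff_nonMin (hL : 1 ≤ L) (hn : 1 ≤ n) (hP : P.Controllable) (hO : P.Observable)
    {ud : ℕ → Fin m → ℝ} {xd : ℕ → Fin n → ℝ} {yd : ℕ → Fin p → ℝ}
    (h : P.IsStateTrajectory (N + n) ud xd yd) (hu : PersistentlyExciting (L + 2 * n) N ud)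
    {G : Matrix (Fin N) (Fin m ⊕ NonMin n m p) ℝ}
    (hG : IsGenInverse (regressor n N ud (nonMinData n ud yd)) G)
    (ub : ℕ → Fin m → ℝ) (yb : ℕ → Fin p → ℝ) :
    HankelModel n L N ud yd ub yb ↔
      P.IsTrajectory n ub yb ∧
      EDDPCModel n L N (nonMinData n ud yd) G (fun k => ub (n + k)) (ioWindow n ub yb) := by
  constructor
  · rintro ⟨α, hα⟩
    have hx := h.of_hankelEq hα
    exact ⟨⟨_, hx.mono (by omega)⟩, fun k hk =>
      (hO.predictor_nonMin hL hn hP h hu hG hx (by omega)).symm⟩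
  · rintro ⟨⟨x, hx⟩, hE⟩
    have htraj := P.isStateTrajectory_response (L + n) (x 0) ub
    have hy : ∀ i, i < L + n → yb i = P.output (x 0) ub i := by
      intro i
      induction i using Nat.strong_induction_on with
      | _ i ih =>
        intro hi
        rcases lt_or_ge i n with hin | hin
        · exact (hx.eq_response (u' := ub) fun _ _ => rfl).2 i hin
        · obtain ⟨k, rfl⟩ := Nat.exists_eq_add_of_le hin
          have h1 : ioWindow n ub yb k = ioWindow n ub (P.output (x 0) ub) k :=
            ioWindow_inj.mpr fun j hj => ⟨rfl, ih _ (by omega) (by omega)⟩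
          have h2 := hE k (by omega)
          rw [h1, hO.predictor_nonMin hL hn hP h hu hG htraj (by omega), ioWindow_inj] at h2
          -- the new output is the last one of the window
          have h3 := (h2 (n - 1) (by omega)).2
          rwa [show k + 1 + (n - 1) = n + k by omega] at h3
    obtain ⟨α, hα, -⟩ := hP.exists_hankelEq h hu htraj
    refine ⟨α, hankelEq_iff.mpr fun i hi => ?_⟩
    rw [hy i hi]
    exact hankelEq_iff.mp hα i hi

/-- Equivalence of the models for the non-minimal state, on the level of predicted sequences. -/
theorem eddpcModel_iff_nonMin (hL : 1 ≤ L) (hn : 1 ≤ n) (hP : P.Controllable) (hO : P.Observable)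
    {ud : ℕ → Fin m → ℝ} {xd : ℕ → Fin n → ℝ} {yd : ℕ → Fin p → ℝ}
    (h : P.IsStateTrajectory (N + n) ud xd yd) (hu : PersistentlyExciting (L + 2 * n) N ud)
    {G : Matrix (Fin N) (Fin m ⊕ NonMin n m p) ℝ}
    (hG : IsGenInverse (regressor n N ud (nonMinData n ud yd)) G)
    (ub : ℕ → Fin m → ℝ) (zb : ℕ → NonMin n m p → ℝ) :
    ((∃ ub' yb', P.IsTrajectory n ub' yb' ∧ zb 0 = ioWindow n ub' yb' 0) ∧
        EDDPCModel n L N (nonMinData n ud yd) G ub zb) ↔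
      ∃ α ub' yb', HankelEq n L N ud yd α ub' yb' ∧
        zb 0 = ioWindow n ub' yb' 0 ∧
        (∀ k < L, ub' (n + k) = ub k) ∧
        hankel L (N + 1 - (L + n)) (fun k => nonMinData n ud yd (n + 1 + k)) *ᵥ α =
          stack L (fun k => zb (1 + k)) := by
  have hshift (α : Fin (N + 1 - (L + n)) → ℝ) (k : ℕ) :
      slide α (fun k => nonMinData n ud yd (n + 1 + k)) k =
        ioWindow n (slide α ud) (slide α yd) (1 + k) := by
    rw [← slide_nonMinData]
    simp only [slide, add_assoc]
  have hwin {α ub' yb'} (hα : HankelEq n L N ud yd α ub' yb') {k : ℕ} (hk : k ≤ L) :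
      ioWindow n (slide α ud) (slide α yd) k = ioWindow n ub' yb' k :=
    ioWindow_inj.mpr fun i hi => hankelEq_iff.mp hα _ (by omega)
  simp only [hankel_mulVec, stack_inj, hshift]
  constructor
  · rintro ⟨⟨u, y, ⟨x, hx⟩, hz0⟩, hE⟩
    set w : ℕ → Fin m → ℝ := fun i => if i < n then u i else ub (i - n) with hw
    have hwu : ∀ k < n, u k = w k := fun k hk => by simp [hw, hk]
    have hwub : ∀ k < L, w (n + k) = ub k := fun k _ => by simp [hw]
    have htraj := P.isStateTrajectory_response (L + n) (x 0) w
    have hz : ∀ k ≤ L, zb k = ioWindow n w (P.output (x 0) w) k := by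
      intro k
      induction k with
      | zero =>
        intro _
        rw [hz0, ioWindow_inj]
        intro i hi
        rw [zero_add]
        exact ⟨hwu i hi, (hx.eq_response hwu).2 i hi⟩
      | succ k ih =>
        intro hk
        rw [hE k hk, ih (by omega), ← hwub k hk,
          hO.predictor_nonMin hL hn hP h hu hG htraj (by omega)]
    obtain ⟨α, hα, -⟩ := hP.exists_hankelEq h hu htraj
    refine ⟨α, w, _, hα, hz 0 (by omega), hwub, fun k hk => ?_⟩
    rw [hwin hα (by omega), hz _ (by omega)]
  · rintro ⟨α, ub', yb', hα, hz0, hub, hzb⟩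
    have hx := h.of_hankelEq hα
    have hz : ∀ k ≤ L, zb k = ioWindow n ub' yb' k := by
      rintro (_ | k) hk
      · exact hz0
      · rw [add_comm k 1, ← hzb k hk, hwin hα (by omega)]
    refine ⟨⟨ub', yb', ⟨_, hx.mono (by omega)⟩, hz0⟩, fun k hk => ?_⟩
    rw [hz k hk.le, hz _ hk, ← hub k hk, hO.predictor_nonMin hL hn hP h hu hG hx (by omega)]

end NonMinimal

end LTISystem

/-- Equivalence of the trajectory-based and of the one-step state-space predictive models.
First part: the state is fully measured (`y = x`). Second part: non-minimal state. -/
theorem mainTheorem4 (n m L N : ℕ) (hn : 1 ≤ n) (hL : 1 ≤ L) :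
    -- fully measured state
    (∀ (P : LTISystem n m n), P.Controllable → P.Observable → P.C = 1 → P.D = 0 →
      ∀ (ud : ℕ → Fin m → ℝ) (xd yd : ℕ → Fin n → ℝ),
        P.IsStateTrajectory (N + n) ud xd yd →
        PersistentlyExciting (L + 2 * n) N ud →
        (∃ R : Matrix (Fin N) (Fin m ⊕ Fin n) ℝ, regressor n N ud xd * R = 1) ∧
        ∀ G, IsGenInverse (regressor n N ud xd) G →
          -- the same predictions from every given past
          (∀ (ub : ℕ → Fin m → ℝ) (yb : ℕ → Fin n → ℝ),
            HankelModel n L N ud yd ub yb ↔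
              (∃ x, P.IsStateTrajectory n ub x yb ∧ x n = yb n) ∧
              ∃ xb : ℕ → Fin n → ℝ, (∀ k < L, xb k = yb (n + k)) ∧
                EDDPCModel n L N xd G (fun k => ub (n + k)) xb) ∧
          -- the same predicted sequences, `x̄_{[1,L]} = H_L(x_d⁺) α`
          (∀ (ub : ℕ → Fin m → ℝ) (xb : ℕ → Fin n → ℝ),
            EDDPCModel n L N xd G ub xb ↔
              ∃ α ub' yb', HankelEq n L N ud yd α ub' yb' ∧
                (∀ k < L, ub' (n + k) = ub k ∧ yb' (n + k) = xb k) ∧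
                hankel L (N + 1 - (L + n)) (fun k => xd (n + 1 + k)) *ᵥ α =
                  stack L (fun k => xb (1 + k)))) ∧
    -- non-minimal state
    (∀ (p : ℕ) (P : LTISystem n m p), P.Controllable → P.Observable →
      ∀ (ud : ℕ → Fin m → ℝ) (yd : ℕ → Fin p → ℝ),
        P.IsTrajectory (N + n) ud yd →
        PersistentlyExciting (L + 2 * n) N ud →
        (p = 1 → ∃ R : Matrix (Fin N) (Fin m ⊕ NonMin n m p) ℝ,
          regressor n N ud (nonMinData n ud yd) * R = 1) ∧
        ∀ G, IsGenInverse (regressor n N ud (nonMinData n ud yd)) G →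
          -- the same predictions from every given past
          (∀ (ub : ℕ → Fin m → ℝ) (yb : ℕ → Fin p → ℝ),
            HankelModel n L N ud yd ub yb ↔
              P.IsTrajectory n ub yb ∧
              EDDPCModel n L N (nonMinData n ud yd) G (fun k => ub (n + k))
                (ioWindow n ub yb)) ∧
          -- the same predicted sequences, `z̄_{[1,L]} = H_L(z_d⁺) α`
          (∀ (ub : ℕ → Fin m → ℝ) (zb : ℕ → NonMin n m p → ℝ),
            ((∃ ub' yb', P.IsTrajectory n ub' yb' ∧ zb 0 = ioWindow n ub' yb' 0) ∧
                EDDPCModel n L N (nonMinData n ud yd) G ub zb) ↔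
              ∃ α ub' yb', HankelEq n L N ud yd α ub' yb' ∧
                zb 0 = ioWindow n ub' yb' 0 ∧
                (∀ k < L, ub' (n + k) = ub k) ∧
                hankel L (N + 1 - (L + n)) (fun k => nonMinData n ud yd (n + 1 + k)) *ᵥ α =
                  stack L (fun k => zb (1 + k)))) := by
  refine ⟨fun P hP _ hC hD ud xd yd h hu => ?_, fun p P hP hO ud yd ⟨xd, h⟩ hu => ?_⟩
  · exact ⟨hP.exists_regressor_rightInverse hL hn h hu, fun G hG =>
      ⟨P.hankelModel_iff_state hL hn hP hC hD h hu hG,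
        P.eddpcModel_iff_state hL hn hP hC hD h hu hG⟩⟩
  · exact ⟨hO.exists_regressor_nonMin_rightInverse hL hn hP h hu, fun G hG =>
      ⟨P.hankelModel_iff_nonMin hL hn hP hO h hu hG,
        P.eddpcModel_iff_nonMin hL hn hP hO h hu hG⟩⟩
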